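/- Let $R$ be a (commutative) Noetherian local ring. A local homomorphism of local rings $R\to S$ is an *étale extension* if it is flat, essentially of finite type, and separable, i.e. the multiplication map $S\otimes_R S\to S$ splits as a homomorphism of $S\otimes_R S$-modules. It is a *pointed étale neighborhood* of $R$ if, in addition, it induces an isomorphism on residue fields. The *Henselization* $R^{\mathrm h}$ is the direct limit of the direct system of all pointed étale neighborhoods of $R$, with local $R$-algebra homomorphisms as transition maps. Then: 1. For every proper ideal $\mathfrak a\subsetneq R$, the $\mathfrak a$-adic completion $\widehat R^{\mathfrak a}=\varprojlim_n R/\mathfrak a^n$ is a projective $R$-module if and only if $R$ is $\mathfrak a$-adically complete (i.e. the natural map $R\to\widehat R^{\mathfrak a}$ is bijective). 2. The Henselization $R^{\mathrm h}$ is a projective $R$-module if and only if $R$ is Henselian. 3. If $R\to R'$ is a pointed étale neighborhood and $R'$ is a projective $R$-module, then $R\to R'$ is an isomorphism. -/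

import Mathlib

universe u v

open IsLocalRing

/-- `S` is a separable `R`-algebra: the multiplication map `S ⊗[R] S → S` has a section `σ` that is
linear over `S ⊗[R] S`, which acts on `S` through the multiplication map. -/
def IsSeparableAlgebra (R : Type u) (S : Type v) [CommRing R] [CommRing S] [Algebra R S] : Prop :=
  ∃ σ : S →+ TensorProduct R S S,
    (∀ (t : TensorProduct R S S) (s : S),
      σ (Algebra.TensorProduct.lmul' R t * s) = t * σ s) ∧
    ∀ s : S, Algebra.TensorProduct.lmul' R (σ s) = s

/-- The local homomorphism of local rings `R → S` is an étale extension: it is flat, separable and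
essentially of finite type. -/
structure IsEtaleExtension (R : Type u) (S : Type v) [CommRing R] [CommRing S] [IsLocalRing R]
    [IsLocalRing S] [Algebra R S] [IsLocalHom (algebraMap R S)] : Prop where
  flat : Module.Flat R S
  separable : IsSeparableAlgebra R S
  essFiniteType : Algebra.EssFiniteType R S

/-- The local homomorphism of local rings `R → S` is a pointed étale neighborhood: it is an étale
extension and induces an isomorphism of residue fields. -/
structure IsPointedEtaleNhd (R : Type u) (S : Type v) [CommRing R] [CommRing S] [IsLocalRing R]
    [IsLocalRing S] [Algebra R S] [IsLocalHom (algebraMap R S)] : Prop extends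
    IsEtaleExtension R S where
  residue_bijective : Function.Bijective (ResidueField.map (algebraMap R S))

/-- The pointed étale neighborhoods of the local ring `R`, as bundled objects. -/
structure PointedEtaleNhd (R : Type u) [CommRing R] [IsLocalRing R] : Type (u + 1) where
  carrier : Type u
  [commRing : CommRing carrier]
  [isLocalRing : IsLocalRing carrier]
  [algebra : Algebra R carrier]
  [isLocalHom : IsLocalHom (algebraMap R carrier)]
  isPointedEtaleNhd : IsPointedEtaleNhd R carrier

namespace PointedEtaleNhd

variable {R : Type u} [CommRing R] [IsLocalRing R]

attribute [instance] commRing isLocalRing algebra isLocalHom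

/-- The index set of the direct system: `S ≤ T` if there is a local `R`-algebra homomorphism
`S → T`.  Objects that are isomorphic over `R` are equivalent for this preorder, so the direct
limit over it is the direct limit over the isomorphism classes. -/
instance : Preorder (PointedEtaleNhd R) where
  le S T := ∃ f : S.carrier →ₐ[R] T.carrier, IsLocalHom f
  le_refl S := ⟨AlgHom.id R S.carrier, ⟨fun _ h => h⟩⟩
  le_trans S T U := by
    rintro ⟨f, hf⟩ ⟨g, hg⟩
    exact ⟨g.comp f, ⟨fun a h => hf.map_nonunit a (hg.map_nonunit (f a) h)⟩⟩

/-- There is at most one local `R`-algebra homomorphism between two pointed étale neighborhoods,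
so the transition maps of the direct system involve no choice. -/
theorem algHom_unique {S T : PointedEtaleNhd R} (f g : S.carrier →ₐ[R] T.carrier)
    (hf : IsLocalHom f) (hg : IsLocalHom g) : f = g := by
  obtain ⟨σ, hσ, hσ'⟩ := S.isPointedEtaleNhd.separable
  set e := σ 1 with he
  obtain ⟨m, hm⟩ : ∃ m : TensorProduct R S.carrier S.carrier →ₐ[R] T.carrier,
      ∀ a b, m (TensorProduct.tmul R a b) = f a * g b :=
    ⟨Algebra.TensorProduct.lift f g (fun _ _ => Commute.all _ _), fun a b => by
      rw [Algebra.TensorProduct.lift_tmul]⟩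
  -- `f` and `g` agree modulo the maximal ideal
  have hmax : ∀ s, residue T.carrier (f s) = residue T.carrier (g s) := by
    intro s
    obtain ⟨k, hk⟩ := S.isPointedEtaleNhd.residue_bijective.2 (residue S.carrier s)
    obtain ⟨r, rfl⟩ := residue_surjective k
    rw [ResidueField.map_residue] at hk
    have hmem : algebraMap R S.carrier r - s ∈ maximalIdeal S.carrier := by
      rw [← residue_eq_zero_iff, map_sub, hk, sub_self]
    have key : ∀ h : S.carrier →ₐ[R] T.carrier, IsLocalHom h →
        residue T.carrier (h s) = residue T.carrier (algebraMap R T.carrier r) := by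
      intro h hh
      have : h (algebraMap R S.carrier r - s) ∈ maximalIdeal T.carrier := by
        rw [mem_maximalIdeal, mem_nonunits_iff] at hmem ⊢
        exact fun hu => hmem (hh.map_nonunit _ hu)
      rw [← residue_eq_zero_iff, map_sub, map_sub, AlgHom.commutes, sub_eq_zero] at this
      exact this.symm
    rw [key f hf, key g hg]
  have hres : ∀ t, residue T.carrier (m t)
      = residue T.carrier (f (Algebra.TensorProduct.lmul' R t)) := by
    intro t
    induction t using TensorProduct.induction_on with
    | zero => simp
    | tmul a b => simp [hm, hmax b]
    | add a b ha hb => simp only [map_add, ha, hb]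
  have hunit : IsUnit (m e) := by
    have h1 : residue T.carrier (m e) = 1 := by rw [hres, he, hσ']; simp
    by_contra hn
    have : residue T.carrier (m e) = 0 :=
      (residue_eq_zero_iff _).2 ((mem_maximalIdeal _).2 hn)
    rw [this] at h1
    exact zero_ne_one h1
  ext s
  have h1 := hσ (TensorProduct.tmul R s 1) 1
  have h2 := hσ (TensorProduct.tmul R 1 s) 1
  simp only [Algebra.TensorProduct.lmul'_apply_tmul, mul_one, one_mul] at h1 h2
  have h3 := congrArg m (h1.symm.trans h2)
  simp only [map_mul] at h3
  have h4 : f s * m e = g s * m e := by simpa [hm, he] using h3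
  exact hunit.mul_right_cancel h4

/-- The transition map `S → T` of the direct system: the unique local `R`-algebra homomorphism. -/
noncomputable def transition (S T : PointedEtaleNhd R) (h : S ≤ T) :
    S.carrier →ₐ[R] T.carrier :=
  Classical.choose h

instance isLocalHom_transition (S T : PointedEtaleNhd R) (h : S ≤ T) :
    IsLocalHom (transition S T h) :=
  Classical.choose_spec h

instance directedSystem_transition :
    DirectedSystem (fun S : PointedEtaleNhd R => S.carrier)
      (fun S T h => transition S T h) where
  map_self S x := by
    rw [algHom_unique (transition S S le_rfl) (AlgHom.id R _) inferInstance ⟨fun _ h => h⟩]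
    rfl
  map_map U T S hST hTU x := by
    rw [algHom_unique (transition S U (hST.trans hTU))
      ((transition T U hTU).comp (transition S T hST)) inferInstance
      ⟨fun a h => (isLocalHom_transition S T hST).map_nonunit a
        ((isLocalHom_transition T U hTU).map_nonunit _ h)⟩]
    rfl

end PointedEtaleNhd

/-- The trivial pointed étale neighborhood `R → R`. -/
def PointedEtaleNhd.trivial (R : Type u) [CommRing R] [IsLocalRing R] : PointedEtaleNhd R :=
  haveI : IsLocalHom (algebraMap R R) := ⟨fun _ h => h⟩
  { carrier := R
    isPointedEtaleNhd :=
      { flat := inferInstance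
        separable := by
          refine ⟨((Algebra.TensorProduct.lid R R).symm : R →+ TensorProduct R R R), ?_, ?_⟩
          · intro t s
            have ht : Algebra.TensorProduct.lmul' R t = Algebra.TensorProduct.lid R R t := by
              induction t using TensorProduct.induction_on with
              | zero => simp
              | tmul a b => simp
              | add a b ha hb => simp only [map_add, ha, hb]
            apply (Algebra.TensorProduct.lid R R).injective
            simp [ht]
          · intro s
            simp
        essFiniteType := inferInstance
        residue_bijective := by
          constructor
          · exact RingHom.injective _
          · intro k
            obtain ⟨r, rfl⟩ := residue_surjective k
            exact ⟨residue R r, ResidueField.map_residue _ r⟩ } }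

/-- The Henselization of the local ring `R`: the direct limit of the direct system of all its
pointed étale neighborhoods. -/
def Henselization (R : Type u) [CommRing R] [IsLocalRing R] : Type (u + 1) :=
  Ring.DirectLimit (fun S : PointedEtaleNhd R => S.carrier)
    (fun S T h => PointedEtaleNhd.transition S T h)

noncomputable instance (R : Type u) [CommRing R] [IsLocalRing R] : CommRing (Henselization R) :=
  inferInstanceAs (CommRing (Ring.DirectLimit (fun S : PointedEtaleNhd R => S.carrier)
    (fun S T h => PointedEtaleNhd.transition S T h)))

/-- The canonical map `R → Henselization R`. -/
noncomputable instance (R : Type u) [CommRing R] [IsLocalRing R] : Algebra R (Henselization R) :=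
  RingHom.toAlgebra (Ring.DirectLimit.of (fun S : PointedEtaleNhd R => S.carrier)
    (fun S T h => PointedEtaleNhd.transition S T h) (PointedEtaleNhd.trivial R))

/-!
All three equivalences come from one observation, `bijective_algebraMap_of_projective`: let `R` be
a Noetherian local ring with maximal ideal `𝔪` and `S` an `R`-algebra with `𝔪 S ≠ S` and
`S = R + 𝔪 S`. If `S` is projective over `R`, then `R → S` is bijective. Indeed, some coordinate of
`1` in a free module containing `S` as a summand is a unit, for otherwise `1 ∈ 𝔪 S`. So there is a
linear form `φ` on `S` with `φ 1 = 1`, and `R → S` is split injective. The endomorphism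
`ψ = id - φ(·) 1` of `S` vanishes on `R`, hence maps `S = R + 𝔪 S` into `𝔪 ψ(S)`, and by induction
into `𝔪 ^ n S` for all `n`. The coordinates of `ψ s` lie in `⋂ 𝔪 ^ n`, which is zero by Krull's
intersection theorem, so `ψ = 0`.

The completion at a proper ideal, every pointed étale neighborhood and the Henselization satisfy the
two conditions on `S`; for the Henselization it suffices to look at the images of the pointed étale
neighborhoods, since they generate the direct limit as a ring. It remains to show that `R` is
Henselian if and only if `R → Henselization R` is bijective.

* If `R` is Henselian, every pointed étale neighborhood `S` of `R` is trivial
  (`IsPointedEtaleNhd.bijective_of_henselian`). By the local structure of unramified algebras, `S` is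
  a localization of a quotient of a standard étale algebra. Its generator maps to a simple root
  in `S` of a monic polynomial over `R`; the root comes from `R` because `R` is Henselian and because
  simple roots in a local ring are determined by their residues. Hence `R → S` is surjective,
  and it is injective by faithful flatness.
* Conversely, a simple root modulo `𝔪` of a monic polynomial lifts to a root in some pointed étale
  neighborhood, a localization of a standard étale algebra (`PointedEtaleNhd.exists_root`), and from
  there maps to a root in `Henselization R = R`.
-/

/-! ### Projective algebras over a Noetherian local ring -/

/-- A projective algebra `S` over a Noetherian local ring `(R, 𝔪)` with `S = R + 𝔪 S ≠ 𝔪 S` equals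
`R`. No finiteness of `S` is assumed. -/
theorem IsLocalRing.bijective_algebraMap_of_projective {R : Type u} {S : Type v} [CommRing R]
    [IsLocalRing R] [IsNoetherianRing R] [CommRing S] [Algebra R S] [Module.Projective R S]
    (hS : ∀ s : S, ∃ r : R, s - algebraMap R S r ∈ (maximalIdeal R).map (algebraMap R S))
    (hne : (maximalIdeal R).map (algebraMap R S) ≠ ⊤) :
    Function.Bijective (algebraMap R S) := by
  obtain ⟨c, hc⟩ := Module.projective_def.mp ‹Module.Projective R S›
  have hcoef : ∀ (f : S →ₗ[R] R) (I : Ideal R) (x : S), x ∈ I.map (algebraMap R S) → f x ∈ I := by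
    intro f I x hx
    have hx' : x ∈ I • (⊤ : Submodule R S) := by
      rwa [Ideal.smul_top_eq_map]
    have := Submodule.mem_map_of_mem (f := f) hx'
    rw [Submodule.map_smul''] at this
    exact Ideal.mul_le_left (J := Submodule.map f ⊤) this
  -- otherwise `1`, being the combination of elements of `S` with its own coordinates, is in `𝔪 S`
  obtain ⟨j, hj⟩ : ∃ j, IsUnit (c 1 j) := by
    by_contra! hcon
    refine hne ((Ideal.eq_top_iff_one _).mpr ?_)
    rw [← hc 1, Finsupp.linearCombination_apply]
    refine Ideal.sum_mem _ fun j _ => ?_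
    simp only [id, Algebra.smul_def]
    exact Ideal.mul_mem_right _ _ (Ideal.mem_map_of_mem _ ((mem_maximalIdeal _).mpr (hcon j)))
  let φ : S →ₗ[R] R := (↑hj.unit⁻¹ : R) • (Finsupp.lapply j ∘ₗ c)
  have hφ : φ 1 = 1 := by simp [φ]
  have hφr : ∀ r, φ (algebraMap R S r) = r := fun r => by
    rw [Algebra.algebraMap_eq_smul_one, map_smul, hφ, smul_eq_mul, mul_one]
  let ψ : S →ₗ[R] S := LinearMap.id - Algebra.linearMap R S ∘ₗ φ
  have hψr : ∀ r, ψ (algebraMap R S r) = 0 := fun r => by simp [ψ, hφr]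
  have hψ : ∀ (n : ℕ) (s : S), ψ s ∈ ((maximalIdeal R) ^ n).map (algebraMap R S) := by
    intro n
    induction n with
    | zero => intro s; simp [Ideal.one_eq_top, Ideal.map_top]
    | succ n ih =>
      intro s
      obtain ⟨r, hr⟩ := hS s
      have h1 : ψ s = ψ (s - algebraMap R S r) := by rw [map_sub, hψr, sub_zero]
      rw [h1]
      have h2 : s - algebraMap R S r ∈ maximalIdeal R • (⊤ : Submodule R S) := by
        rwa [Ideal.smul_top_eq_map]
      have h3 := Submodule.mem_map_of_mem (f := ψ) h2
      rw [Submodule.map_smul''] at h3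
      refine Submodule.smul_induction_on h3 ?_ fun x y hx hy => Ideal.add_mem _ hx hy
      rintro a ha _ ⟨t, -, rfl⟩
      rw [Algebra.smul_def, pow_succ', Ideal.map_mul]
      exact Ideal.mul_mem_mul (Ideal.mem_map_of_mem _ ha) (ih t)
  have hzero : ∀ s, ψ s = 0 := by
    intro s
    rw [← hc (ψ s)]
    have : c (ψ s) = 0 := by
      ext i
      have hbot := Ideal.iInf_pow_eq_bot_of_isLocalRing _ (maximalIdeal.isMaximal R).ne_top
      have : c (ψ s) i ∈ ⨅ n, maximalIdeal R ^ n := by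
        rw [Ideal.mem_iInf]
        exact fun n => hcoef (Finsupp.lapply i ∘ₗ c) _ _ (hψ n s)
      rwa [hbot] at this
    rw [this, map_zero]
  exact ⟨Function.LeftInverse.injective hφr, fun s => ⟨φ s, (sub_eq_zero.mp (hzero s)).symm⟩⟩

/-! ### Adic completions -/

theorem AdicCompletion.projective_iff_isAdicComplete {R : Type u} [CommRing R] [IsLocalRing R]
    [IsNoetherianRing R] (I : Ideal R) (hI : I ≠ ⊤) :
    Module.Projective R (AdicCompletion I R) ↔ IsAdicComplete I R := by
  refine ⟨fun _ => ?_, fun _ => .of_equiv (AdicCompletion.ofLinearEquiv I R)⟩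
  have hle : I ≤ maximalIdeal R := le_maximalIdeal hI
  rw [← AdicCompletion.of_bijective_iff]
  refine bijective_algebraMap_of_projective (S := AdicCompletion I R) ?_ ?_
  · intro s
    obtain ⟨r, hr⟩ := Ideal.Quotient.mk_surjective (evalOneₐ I s)
    refine ⟨r, Ideal.map_mono hle ?_⟩
    rw [← ker_evalOneₐ_eq_map I I.fg_of_isNoetherianRing, RingHom.mem_ker]
    change evalOneₐ I (s - algebraMap R _ r) = 0
    rw [map_sub, AlgHom.commutes, ← hr]
    exact sub_self _
  · intro h
    have h1 : ((maximalIdeal R).map (algebraMap R (AdicCompletion I R))).map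
        ((Ideal.Quotient.factor hle).comp (evalOneₐ I).toRingHom) = ⊥ := by
      rw [Ideal.map_map, RingHom.comp_assoc, evalOneₐ_comp_algebraMap_eq_mk]
      rw [eq_bot_iff, Ideal.map_le_iff_le_comap]
      intro x hx
      exact Ideal.Quotient.eq_zero_iff_mem.mpr hx
    rw [h, Ideal.map_top] at h1
    exact top_ne_bot h1

/-! ### Separable algebras -/

theorem IsSeparableAlgebra.formallyUnramified {R : Type u} {S : Type v} [CommRing R] [CommRing S]
    [Algebra R S] [Algebra.EssFiniteType R S] (h : IsSeparableAlgebra R S) :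
    Algebra.FormallyUnramified R S := by
  obtain ⟨σ, hσ, hσ'⟩ := h
  rw [Algebra.FormallyUnramified.iff_exists_tensorProduct]
  refine ⟨σ 1, fun s => ?_, hσ' 1⟩
  have := hσ ((1 : S) ⊗ₜ[R] s - s ⊗ₜ[R] (1 : S)) 1
  simpa using this.symm

theorem Algebra.FormallyUnramified.isSeparableAlgebra {R : Type u} {S : Type v} [CommRing R]
    [CommRing S] [Algebra R S] [Algebra.EssFiniteType R S] [Algebra.FormallyUnramified R S] :
    IsSeparableAlgebra R S := by
  obtain ⟨t, ht, ht1⟩ :=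
    (Algebra.FormallyUnramified.iff_exists_tensorProduct (R := R) (S := S)).mp inferInstance
  -- `t` is annihilated by the kernel of the multiplication map
  have key : ∀ x : TensorProduct R S S,
      (Algebra.TensorProduct.lmul' R x ⊗ₜ[R] (1 : S)) * t = x * t := by
    intro x
    induction x using TensorProduct.induction_on with
    | zero => simp
    | tmul a b =>
      have hb : ((1 : S) ⊗ₜ[R] b) * t = (b ⊗ₜ[R] (1 : S)) * t := by
        rw [← sub_eq_zero, ← sub_mul, ht]
      have : a ⊗ₜ[R] b = (a ⊗ₜ[R] (1 : S)) * ((1 : S) ⊗ₜ[R] b) := by simp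
      rw [this, mul_assoc, hb, ← mul_assoc]
      simp
    | add x y hx hy => simp only [map_add, TensorProduct.add_tmul, add_mul, hx, hy]
  refine ⟨(AddMonoidHom.mulRight t).comp
    (Algebra.TensorProduct.includeLeft (R := R) (S := R) (A := S) (B := S) : S →+ _), ?_, ?_⟩
  · intro x s
    simp only [AddMonoidHom.comp_apply, AddMonoidHom.mulRight_apply]
    have hmul : (Algebra.TensorProduct.includeLeft (R := R) (S := R) (A := S) (B := S) : S →+ _)
        (Algebra.TensorProduct.lmul' R x * s) = (Algebra.TensorProduct.lmul' R x ⊗ₜ[R] (1 : S)) *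
          (s ⊗ₜ[R] (1 : S)) := by simp
    have hs : (Algebra.TensorProduct.includeLeft (R := R) (S := R) (A := S) (B := S) : S →+ _) s =
        s ⊗ₜ[R] (1 : S) := by simp
    rw [hmul, hs, mul_right_comm, key, mul_right_comm, mul_assoc]
  · intro s
    have : Algebra.TensorProduct.lmul' R t = 1 := ht1
    simp [this]

/-! ### Pointed étale neighborhoods of Henselian rings -/

section

variable {R : Type u} {S : Type v} [CommRing R] [CommRing S] [IsLocalRing R] [IsLocalRing S]
    [Algebra R S] [IsLocalHom (algebraMap R S)]

theorem IsPointedEtaleNhd.map_maximalIdeal (h : IsPointedEtaleNhd R S) :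
    (maximalIdeal R).map (algebraMap R S) = maximalIdeal S := by
  have := h.essFiniteType
  have := h.separable.formallyUnramified
  exact Algebra.FormallyUnramified.map_maximalIdeal

theorem IsPointedEtaleNhd.exists_sub_mem (h : IsPointedEtaleNhd R S) (s : S) :
    ∃ r : R, s - algebraMap R S r ∈ (maximalIdeal R).map (algebraMap R S) := by
  obtain ⟨k, hk⟩ := h.residue_bijective.2 (residue S s)
  obtain ⟨r, rfl⟩ := residue_surjective k
  refine ⟨r, ?_⟩
  rw [h.map_maximalIdeal, ← residue_eq_zero_iff, map_sub, ← hk, ResidueField.map_residue, sub_self]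

theorem IsPointedEtaleNhd.bijective_of_projective [IsNoetherianRing R]
    (h : IsPointedEtaleNhd R S) [Module.Projective R S] : Function.Bijective (algebraMap R S) :=
  bijective_algebraMap_of_projective h.exists_sub_mem
    (h.map_maximalIdeal ▸ (maximalIdeal.isMaximal S).ne_top)

/-- Simple roots in a local ring are determined by their residues. -/
theorem Polynomial.eq_of_isRoot_of_sub_mem_maximalIdeal {S : Type v} [CommRing S] [IsLocalRing S]
    {f : Polynomial S} {x y : S} (hx : f.IsRoot x) (hy : f.IsRoot y)
    (hf : IsUnit (f.derivative.eval x)) (hxy : y - x ∈ maximalIdeal S) : y = x := by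
  obtain ⟨k, hk⟩ := f.binomExpansion x (y - x)
  rw [add_sub_cancel, hy.eq_zero, hx.eq_zero, zero_add] at hk
  have hu : IsUnit (f.derivative.eval x + k * (y - x)) := by
    by_contra hn
    have := Ideal.sub_mem _ ((mem_maximalIdeal _).mpr hn) (Ideal.mul_mem_left _ k hxy)
    rw [add_sub_cancel_right] at this
    exact (mem_maximalIdeal _).mp this hf
  have h0 : (f.derivative.eval x + k * (y - x)) * (y - x) = 0 := by rw [hk]; ring
  exact sub_eq_zero.mp (hu.mul_right_eq_zero.mp h0)

/-- Over a Henselian ring, every point of a standard étale algebra in a pointed étale neighborhood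
comes from a point in the base ring. -/
theorem IsPointedEtaleNhd.exists_eq_algebraMap_of_hasMap (h : IsPointedEtaleNhd R S)
    (hR : HenselianLocalRing R) (P : StandardEtalePair R) {x : S} (hx : P.HasMap x) :
    ∃ a : R, P.HasMap a ∧ algebraMap R S a = x := by
  obtain ⟨a₀, ha₀⟩ := h.exists_sub_mem x
  rw [h.map_maximalIdeal] at ha₀
  -- for any polynomial `p`, the values `p a₀` and `p x` are congruent
  have hcongr : ∀ (p : Polynomial R) (a : R), x - algebraMap R S a ∈ maximalIdeal S →
      Polynomial.aeval x p - algebraMap R S (p.eval a) ∈ maximalIdeal S := by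
    intro p a ha
    have := Polynomial.sub_dvd_eval_sub x (algebraMap R S a) (p.map (algebraMap R S))
    rw [Polynomial.eval_map_algebraMap, Polynomial.eval_map_apply] at this
    exact Ideal.mem_of_dvd _ this ha
  have hunit : ∀ (p : Polynomial R) (a : R), x - algebraMap R S a ∈ maximalIdeal S →
      IsUnit (Polynomial.aeval x p) → IsUnit (p.eval a) := by
    intro p a ha hp
    refine isUnit_of_map_unit (algebraMap R S) _ ?_
    by_contra hn
    have := Ideal.add_mem _ (hcongr p a ha) ((mem_maximalIdeal _).mpr hn)
    rw [sub_add_cancel] at this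
    exact (mem_maximalIdeal _).mp this hp
  have hfa₀ : P.f.eval a₀ ∈ maximalIdeal R := by
    rw [mem_maximalIdeal, mem_nonunits_iff]
    intro hu
    have := hcongr P.f a₀ ha₀
    rw [hx.1, zero_sub, neg_mem_iff] at this
    exact (mem_maximalIdeal _).mp this (hu.map _)
  obtain ⟨a, ha, haa₀⟩ := hR.is_henselian P.f P.monic_f a₀ hfa₀
    (hunit _ _ ha₀ hx.isUnit_derivative_f)
  have hxa : x - algebraMap R S a ∈ maximalIdeal S := by
    have h1 : algebraMap R S (a - a₀) ∈ maximalIdeal S := by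
      rw [← h.map_maximalIdeal]; exact Ideal.mem_map_of_mem _ haa₀
    have := Ideal.sub_mem _ ha₀ h1
    rwa [map_sub, sub_sub_sub_cancel_right] at this
  refine ⟨a, ⟨by simpa using ha, by simpa using hunit P.g a hxa hx.2⟩, ?_⟩
  refine (Polynomial.eq_of_isRoot_of_sub_mem_maximalIdeal (f := P.f.map (algebraMap R S))
    ?_ ?_ ?_ hxa).symm
  · exact ha.map
  · rw [Polynomial.IsRoot, Polynomial.eval_map_algebraMap, hx.1]
  · rw [Polynomial.derivative_map, Polynomial.eval_map_apply]
    exact (hunit _ a hxa hx.isUnit_derivative_f).map _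

open Algebra in
theorem IsPointedEtaleNhd.bijective_of_henselian (h : IsPointedEtaleNhd R S)
    (hR : HenselianLocalRing R) : Function.Bijective (algebraMap R S) := by
  have := h.flat
  have := h.essFiniteType
  have := h.separable.formallyUnramified
  have := Module.FaithfullyFlat.of_flat_of_isLocalHom (A := R) (B := S)
  refine ⟨FaithfulSMul.algebraMap_injective R S, ?_⟩
  -- `S` is the localization of the finite type algebra `A` at the prime `q`
  let A := EssFiniteType.subalgebra R S
  let q : Ideal A := (maximalIdeal S).comap (algebraMap A S)
  have hq : q.primeCompl = EssFiniteType.submonoid R S := by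
    ext a
    simp [q, EssFiniteType.submonoid, Ideal.primeCompl, IsUnit.mem_submonoid_iff]
  have hloc : IsLocalization.AtPrime S q := by
    rw [IsLocalization.AtPrime, hq]; infer_instance
  have : IsUnramifiedAt R q :=
    .of_equiv (((IsLocalization.algEquiv q.primeCompl S (Localization.AtPrime q)).restrictScalars R))
  -- a standard étale algebra `P.Ring` surjects onto `A[1/g]`, through which `A → S` factors
  obtain ⟨g, hgq, P, φ, hφ⟩ := IsUnramifiedAt.exists_hasStandardEtaleSurjectionOn (R := R) q
  have hg : IsUnit (algebraMap A S g) := by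
    have := IsLocalization.map_units S (⟨g, hgq⟩ : q.primeCompl)
    exact this
  let ψ : Localization.Away g →ₐ[A] S := IsLocalization.Away.liftAlgHom g (f := Algebra.ofId A S) hg
  let χ : P.Ring →ₐ[R] S := (ψ.restrictScalars R).comp φ
  obtain ⟨a, ha, hax⟩ := h.exists_eq_algebraMap_of_hasMap hR P (P.hasMap_X.map χ)
  have hχ : χ = (Algebra.ofId R S).comp (P.lift a ha) := P.hom_ext (by simp [← hax, ofId_apply])
  -- the image of `P.Ring` in `S`, and with it that of `A`, is contained in the image of `R`
  have hA : ∀ b : A, ∃ r : R, algebraMap R S r = algebraMap A S b := by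
    intro b
    obtain ⟨p, hp⟩ := hφ (algebraMap A _ b)
    refine ⟨P.lift a ha p, ?_⟩
    have h1 : χ p = algebraMap A S b := by
      change ψ (φ p) = _
      rw [hp, AlgHom.commutes]
    rw [← h1, hχ]
    rfl
  intro s
  obtain ⟨⟨b, t⟩, hbt⟩ := IsLocalization.surj q.primeCompl s
  obtain ⟨r, hr⟩ := hA b
  obtain ⟨w, hw⟩ := hA t
  have hw' : IsUnit (algebraMap R S w) := hw ▸ IsLocalization.map_units S t
  obtain ⟨u, rfl⟩ := isUnit_of_map_unit (algebraMap R S) _ hw'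
  refine ⟨r * ↑u⁻¹, ?_⟩
  rw [← hw'.mul_left_inj, ← map_mul, Units.inv_mul_cancel_right, hr, hw, hbt]

end

/-! ### Pointed étale neighborhoods from simple roots -/

/-- A pointed étale neighborhood has exactly one point over the residue field of the base ring. -/
theorem IsPointedEtaleNhd.existsUnique_ringHom_residueField {R : Type u} {S : Type v} [CommRing R]
    [CommRing S] [IsLocalRing R] [IsLocalRing S] [Algebra R S] [IsLocalHom (algebraMap R S)]
    (h : IsPointedEtaleNhd R S) :
    ∃! g : S →+* ResidueField R, g.comp (algebraMap R S) = residue R := by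
  let e := RingEquiv.ofBijective _ h.residue_bijective
  -- such a homomorphism kills `𝔪 S`
  have hker : ∀ g : S →+* ResidueField R, g.comp (algebraMap R S) = residue R →
      ∀ (s : S) (r : R), s - algebraMap R S r ∈ (maximalIdeal R).map (algebraMap R S) →
        g s = residue R r := by
    intro g hg s r hr
    have h1 := Ideal.mem_map_of_mem g hr
    rw [Ideal.map_map, hg, (Ideal.map_eq_bot_iff_le_ker _).mpr ker_residue.ge,
      Ideal.mem_bot, map_sub, sub_eq_zero] at h1
    exact h1.trans (DFunLike.congr_fun hg r)
  have he : ((e.symm : _ →+* _).comp (residue S)).comp (algebraMap R S) = residue R := by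
    ext r
    exact e.symm_apply_eq.mpr (ResidueField.map_residue _ r).symm
  refine ⟨_, he, fun g hg => ?_⟩
  ext s
  obtain ⟨r, hr⟩ := h.exists_sub_mem s
  rw [hker g hg s r hr, hker _ he s r hr]

/-- The local ring of an étale `R`-algebra at a point with values in the residue field of `R` is a
pointed étale neighborhood of `R`. -/
theorem isPointedEtaleNhd_localization_ker {R : Type u} {A : Type v} [CommRing R] [IsLocalRing R]
    [CommRing A] [Algebra R A] [Algebra.Etale R A] (φ : A →ₐ[R] ResidueField R)
    [(RingHom.ker φ).IsPrime] :
    ∃ _ : IsLocalHom (algebraMap R (Localization.AtPrime (RingHom.ker φ))),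
      IsPointedEtaleNhd R (Localization.AtPrime (RingHom.ker φ)) := by
  set q : Ideal A := RingHom.ker φ with hq
  let S := Localization.AtPrime q
  let Φ : S →ₐ[R] ResidueField R := IsLocalization.liftAlgHom (M := q.primeCompl) (f := φ)
    fun y => isUnit_iff_ne_zero.mpr y.2
  have hΦ : ∀ s : S, Φ s = 0 → s ∈ maximalIdeal S := fun s hs =>
    (mem_maximalIdeal _).mpr fun hu => (hu.map Φ).ne_zero hs
  have hloc : IsLocalHom (algebraMap R S) := by
    refine ⟨fun r hr => ?_⟩
    have := hr.map Φ
    rw [AlgHom.commutes] at this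
    by_contra hn
    exact this.ne_zero ((residue_eq_zero_iff r).mpr ((mem_maximalIdeal r).mpr hn))
  have : Algebra.FormallyEtale A S := Algebra.FormallyEtale.of_isLocalization q.primeCompl
  have : Algebra.FormallyEtale R S := Algebra.FormallyEtale.comp R A S
  have : Algebra.EssFiniteType A S := Algebra.EssFiniteType.of_isLocalization S q.primeCompl
  have hess : Algebra.EssFiniteType R S := Algebra.EssFiniteType.comp R A S
  have : Module.Flat A S := IsLocalization.flat S q.primeCompl
  refine ⟨hloc, ⟨⟨Module.Flat.trans R A S,
    Algebra.FormallyUnramified.isSeparableAlgebra, hess⟩, RingHom.injective _, fun k => ?_⟩⟩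
  obtain ⟨s, rfl⟩ := residue_surjective k
  obtain ⟨r, hr⟩ := residue_surjective (Φ s)
  refine ⟨residue R r, ?_⟩
  rw [ResidueField.map_residue, ← sub_eq_zero, ← map_sub, residue_eq_zero_iff]
  refine hΦ _ ?_
  rw [map_sub, AlgHom.commutes, ← hr]
  exact sub_self _

/-- A simple root modulo the maximal ideal of a monic polynomial lifts to a root in some pointed
étale neighborhood. -/
theorem PointedEtaleNhd.exists_root {R : Type u} [CommRing R] [IsLocalRing R]
    {f : Polynomial R} (hf : f.Monic) {a₀ : R} (h₀ : f.eval a₀ ∈ maximalIdeal R)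
    (h₁ : IsUnit (f.derivative.eval a₀)) :
    ∃ (T : PointedEtaleNhd R) (x : T.carrier), Polynomial.aeval x f = 0 ∧
      x - algebraMap R T.carrier a₀ ∈ maximalIdeal T.carrier := by
  -- the standard étale algebra `R[X][1 / f'] / f`
  let P : StandardEtalePair R := ⟨f, hf, f.derivative, 1, 0, 1, by simp⟩
  have hP : P.HasMap (residue R a₀) := by
    have hev : ∀ p : Polynomial R, Polynomial.aeval (residue R a₀) p = residue R (p.eval a₀) :=
      fun p => Polynomial.aeval_algebraMap_apply_eq_algebraMap_eval a₀ p
    exact ⟨by rw [hev]; exact (residue_eq_zero_iff _).mpr h₀, by rw [hev]; exact h₁.map _⟩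
  let φ := P.lift _ hP
  have hprime : (RingHom.ker φ).IsPrime := RingHom.ker_isPrime φ
  obtain ⟨hloc, hT⟩ := isPointedEtaleNhd_localization_ker φ
  refine ⟨⟨Localization.AtPrime (RingHom.ker φ), hT⟩, algebraMap P.Ring _ P.X, ?_, ?_⟩
  · change Polynomial.aeval (algebraMap P.Ring (Localization.AtPrime (RingHom.ker φ)) P.X) f = 0
    rw [Polynomial.aeval_algebraMap_apply]
    have : Polynomial.aeval P.X f = 0 := P.hasMap_X.1
    rw [this, map_zero]
  · change algebraMap P.Ring (Localization.AtPrime (RingHom.ker φ)) P.X -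
      algebraMap R (Localization.AtPrime (RingHom.ker φ)) a₀ ∈ maximalIdeal _
    rw [IsScalarTower.algebraMap_apply R P.Ring (Localization.AtPrime (RingHom.ker φ)), ← map_sub,
      ← Localization.AtPrime.map_eq_maximalIdeal]
    refine Ideal.mem_map_of_mem _ ?_
    rw [RingHom.mem_ker, map_sub, AlgHom.commutes]
    simp only [φ, StandardEtalePair.lift_X]
    exact sub_self _

/-! ### The Henselization -/

namespace Henselization

variable {R : Type u} [CommRing R] [IsLocalRing R]

/-- The structure map of a pointed étale neighborhood into the direct limit, as an `R`-algebra
homomorphism. -/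
noncomputable def ofNhd (S : PointedEtaleNhd R) : S.carrier →ₐ[R] Henselization R where
  __ := Ring.DirectLimit.of (fun S : PointedEtaleNhd R => S.carrier)
    (fun S T h => PointedEtaleNhd.transition S T h) S
  commutes' r := by
    have hle : PointedEtaleNhd.trivial R ≤ S :=
      ⟨Algebra.ofId R S.carrier, ⟨fun r h => S.isLocalHom.map_nonunit r h⟩⟩
    have h := Ring.DirectLimit.of_f (G := fun S : PointedEtaleNhd R => S.carrier)
      (f := fun S T h => PointedEtaleNhd.transition S T h) hle r
    have h2 : PointedEtaleNhd.transition _ S hle r = algebraMap R S.carrier r :=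
      (PointedEtaleNhd.transition _ S hle).commutes r
    rw [h2] at h
    exact h

theorem ringHom_ext {P : Type*} [CommRing P] {g₁ g₂ : Henselization R →+* P}
    (h : ∀ (S : PointedEtaleNhd R) (s : S.carrier), g₁ (ofNhd S s) = g₂ (ofNhd S s)) : g₁ = g₂ :=
  Ring.DirectLimit.hom_ext (G := fun S : PointedEtaleNhd R => S.carrier)
    (f := fun S T h => PointedEtaleNhd.transition S T h) P
    fun S => RingHom.ext (h S)

/-- The images of the pointed étale neighborhoods generate the Henselization as a ring. Proving
statements about elements of the Henselization by means of this lemma does not require that the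
direct system is directed. -/
theorem subring_eq_top (T : Subring (Henselization R))
    (hT : ∀ (S : PointedEtaleNhd R) (s : S.carrier), ofNhd S s ∈ T) : T = ⊤ := by
  let L : Henselization R →+* T :=
    Ring.DirectLimit.lift _ _ T (fun S => (ofNhd S).toRingHom.codRestrict T (hT S))
      fun S S' h s => Subtype.ext (Ring.DirectLimit.of_f (G := fun S : PointedEtaleNhd R => S.carrier)
      (f := fun S T h => PointedEtaleNhd.transition S T h) h s)
  have hL : T.subtype.comp L = RingHom.id _ := ringHom_ext fun S s => by
    have : L (ofNhd S s) = (ofNhd S).toRingHom.codRestrict T (hT S) s :=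
      Ring.DirectLimit.lift_of ..
    simp [this]
  refine eq_top_iff.mpr fun x _ => ?_
  rw [← RingHom.id_apply x, ← hL]
  exact (L x).2

/-- If a ring homomorphism `R → P` extends uniquely to every pointed étale neighborhood, the
extensions are compatible with the transition maps and glue to an extension to the Henselization. -/
theorem exists_ringHom {P : Type*} [CommRing P] (c : R →+* P)
    (hc : ∀ S : PointedEtaleNhd R, ∃! g : S.carrier →+* P, g.comp (algebraMap R S.carrier) = c) :
    ∃ g : Henselization R →+* P, g.comp (algebraMap R (Henselization R)) = c := by
  choose g hg hg' using hc
  have hcompat : ∀ (S T : PointedEtaleNhd R) (h : S ≤ T) (s : S.carrier),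
      g T (PointedEtaleNhd.transition S T h s) = g S s := by
    intro S T h s
    refine DFunLike.congr_fun (hg' S ((g T).comp (PointedEtaleNhd.transition S T h).toRingHom) ?_) s
    refine Eq.trans ?_ (hg T)
    ext r
    simp
  refine ⟨Ring.DirectLimit.lift _ _ P g hcompat, ?_⟩
  refine Eq.trans ?_ (hg (PointedEtaleNhd.trivial R))
  ext r
  exact Ring.DirectLimit.lift_of (f := fun S T h => PointedEtaleNhd.transition S T h) P g hcompat _ _

theorem exists_sub_mem (x : Henselization R) :
    ∃ r : R, x - algebraMap R (Henselization R) r ∈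
      (maximalIdeal R).map (algebraMap R (Henselization R)) := by
  set I := (maximalIdeal R).map (algebraMap R (Henselization R)) with hI
  let T : Subring (Henselization R) :=
    ((Ideal.Quotient.mk I).comp (algebraMap R (Henselization R))).range.comap (Ideal.Quotient.mk I)
  have hT : T = ⊤ := subring_eq_top T fun S s => by
    obtain ⟨r, hr⟩ := S.isPointedEtaleNhd.exists_sub_mem s
    refine ⟨r, (Ideal.Quotient.eq.mpr ?_).symm⟩
    have := Ideal.mem_map_of_mem (ofNhd S).toRingHom hr
    rw [Ideal.map_map, AlgHom.toRingHom_eq_coe, AlgHom.comp_algebraMap] at this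
    simpa using this
  obtain ⟨r, hr⟩ : x ∈ T := hT ▸ Subring.mem_top x
  exact ⟨r, Ideal.Quotient.eq.mp hr.symm⟩

theorem map_maximalIdeal_ne_top :
    (maximalIdeal R).map (algebraMap R (Henselization R)) ≠ ⊤ := by
  obtain ⟨g, hg⟩ := exists_ringHom (residue R) fun S =>
    S.isPointedEtaleNhd.existsUnique_ringHom_residueField
  intro h
  have h1 := congrArg (Ideal.map g) h
  rw [Ideal.map_map, hg, Ideal.map_top] at h1
  have h2 : (maximalIdeal R).map (residue R) = ⊥ := (Ideal.map_eq_bot_iff_le_ker _).mpr ker_residue.ge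
  exact bot_ne_top (h2.symm.trans h1)

theorem bijective_algebraMap_of_henselian (hR : HenselianLocalRing R) :
    Function.Bijective (algebraMap R (Henselization R)) := by
  have hbij := fun S : PointedEtaleNhd R => S.isPointedEtaleNhd.bijective_of_henselian hR
  constructor
  · obtain ⟨g, hg⟩ := exists_ringHom (RingHom.id R) fun S => by
      let e := RingEquiv.ofBijective _ (hbij S)
      refine ⟨(e.symm : _ →+* _), RingHom.ext fun r => e.symm_apply_apply r, fun g hg => ?_⟩
      ext s
      obtain ⟨r, rfl⟩ := e.surjective s
      exact (DFunLike.congr_fun hg r).trans (e.symm_apply_apply r).symm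
    exact Function.LeftInverse.injective (DFunLike.congr_fun hg)
  · rw [← RingHom.range_eq_top]
    refine subring_eq_top _ fun S s => ?_
    obtain ⟨r, rfl⟩ := (hbij S).2 s
    exact ⟨r, ((ofNhd S).commutes r).symm⟩

theorem henselianLocalRing_of_bijective
    (h : Function.Bijective (algebraMap R (Henselization R))) : HenselianLocalRing R where
  is_henselian f hf a₀ h₀ h₁ := by
    obtain ⟨T, x, hx, hxa⟩ := PointedEtaleNhd.exists_root hf h₀ h₁
    let e : R ≃ₐ[R] Henselization R := AlgEquiv.ofBijective (Algebra.ofId R _) h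
    let ψ : T.carrier →ₐ[R] R := (e.symm : Henselization R →ₐ[R] R).comp (ofNhd T)
    refine ⟨ψ x, ?_, ?_⟩
    · have := congrArg ψ hx
      rwa [map_zero, ← Polynomial.aeval_algHom_apply, Polynomial.coe_aeval_eq_eval] at this
    · have : ψ (x - algebraMap R T.carrier a₀) ∈ maximalIdeal R := by
        rw [← T.isPointedEtaleNhd.map_maximalIdeal] at hxa
        have := Ideal.mem_map_of_mem ψ.toRingHom hxa
        rw [Ideal.map_map, AlgHom.toRingHom_eq_coe, AlgHom.comp_algebraMap] at this
        simpa [Ideal.map_id] using this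
      rwa [map_sub, AlgHom.commutes] at this

theorem projective_iff_henselianLocalRing [IsNoetherianRing R] :
    Module.Projective R (Henselization R) ↔ HenselianLocalRing R := by
  refine ⟨fun _ => henselianLocalRing_of_bijective
    (bijective_algebraMap_of_projective exists_sub_mem map_maximalIdeal_ne_top), fun hR => ?_⟩
  exact .of_equiv (LinearEquiv.ofBijective (Algebra.linearMap R (Henselization R))
    (bijective_algebraMap_of_henselian hR))

end Henselization

theorem corollary2p6 {R : Type u} [CommRing R] [IsLocalRing R] [IsNoetherianRing R] :
    (∀ 𝔞 : Ideal R, 𝔞 ≠ ⊤ →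
      (Module.Projective R (AdicCompletion 𝔞 R) ↔ IsAdicComplete 𝔞 R)) ∧
    (Module.Projective R (Henselization R) ↔ HenselianLocalRing R) ∧
    (∀ (R' : Type v) [CommRing R'] [IsLocalRing R'] [Algebra R R']
      [IsLocalHom (algebraMap R R')], IsPointedEtaleNhd R R' → Module.Projective R R' →
        Function.Bijective (algebraMap R R')) :=
  ⟨AdicCompletion.projective_iff_isAdicComplete, Henselization.projective_iff_henselianLocalRing,
    fun _ _ _ _ _ h _ => h.bijective_of_projective⟩
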